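/- Throughout, $\mathcal H$ is a complex Hilbert space, subspaces are closed, orthogonal projections are identified with their ranges, and a subspace lattice on a Hilbert space is a set of closed subspaces containing $\{0\}$ and the whole space and closed under arbitrary closed linear spans and intersections. For a subspace lattice $\mathcal L$, $\mathrm{Alg}\,\mathcal L$ is the algebra of bounded operators leaving every member of $\mathcal L$ invariant; $\mathcal L$ is reflexive if it consists of all closed subspaces invariant under every operator in $\mathrm{Alg}\,\mathcal L$. An operator algebra is decomposable if each of its finite-rank operators is a finite sum of rank-one operators belonging to the algebra. Let $\mathcal L_0$ be a reflexive subspace lattice on $\mathcal H$. Consider either of the following two constructions. (a) Let $n_0\ge 2$, let $\mathcal K=\mathcal H^{(n_0)}$ be the Hilbert space direct sum of $n_0$ copies of $\mathcal H$, let $\zeta=(a_1,\dots,a_{n_0})\in\mathbb C^{n_0}$ be a unit vector with all $a_i\neq 0$, let $Q$ be the projection onto the closed span of $\{(a_1x,\dots,a_{n_0}x):x\in\mathcal H\}$, let $F_k=\sum_{j=1}^k E_{jj}\otimes I$, and let $\mathcal L$ be the subspace lattice generated by $\{E_{11}\otimes P,\ Q,\ F_k : P\in\mathcal L_0,\ 2\le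 k\le n_0\}$. (b) Let $\mathcal K=\ell^2(\mathbb N)\otimes\mathcal H$ be the Hilbert space direct sum of countably infinitely many copies of $\mathcal H$, let $\eta=(b_1,b_2,\dots)\in\ell^2(\mathbb N)$ be a unit vector with all $b_i\ne0$, let $Q$ be the projection onto the closed span of $\{(b_1x,b_2x,\dots):x\in\mathcal H\}$, let $F_k=\sum_{j=1}^k E_{jj}\otimes I$, and let $\mathcal L$ be the subspace lattice generated by $\{E_{11}\otimes P,\ Q,\ F_k : P\in\mathcal L_0,\ k\ge 2\}$. A derivation from $\mathrm{Alg}\,\mathcal L$ into $\mathcal B(\mathcal K)$ is a linear map $D$ with $D(AB)=D(A)B+AD(B)$ for all $A,B\in\mathrm{Alg}\,\mathcal L$ (no continuity is assumed), and a local derivation from $\mathrm{Alg}\,\mathcal L$ into $\mathcal B(\mathcal K)$ is a linear map $\delta$ such that for every $A\in\mathrm{Alg}\,\mathcal L$ there is a derivation $D_A$ from $\mathrm{Alg}\,\mathcal L$ into $\mathcal B(\mathcal K)$ with $\delta(A)=D_A(A)$. **Corollary.** Suppose that $\mathrm{Alg}\,\mathcal L_0$ is decomposable and that the linear span of the rank-one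 operators of $\mathrm{Alg}\,\mathcal L_0$ is contained in the linear span of the idempotents of $\mathrm{Alg}\,\mathcal L_0$. Then, in both cases (a) and (b), every local derivation $\delta$ from $\mathrm{Alg}\,\mathcal L$ into $\mathcal B(\mathcal K)$ satisfies $$\delta(MAN)=M\delta(AN)+\delta(MA)N-M\delta(A)N$$ for all $A,M,N\in\mathrm{Alg}\,\mathcal L$ with $M$ and $N$ of finite rank. -/

import Mathlib

open scoped ENNReal

noncomputable section

namespace SubspaceLattice

section General

variable {H : Type*} [NormedAddCommGroup H] [InnerProductSpace ℂ H]

/-- A subspace lattice on `H`: a set of closed subspaces containing `{0}` and `H` and closed under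
arbitrary closed linear spans and arbitrary intersections. -/
structure IsSubspaceLattice (L : Set (ClosedSubmodule ℂ H)) : Prop where
  bot_mem : ⊥ ∈ L
  top_mem : ⊤ ∈ L
  sSup_mem : ∀ S ⊆ L, sSup S ∈ L
  sInf_mem : ∀ S ⊆ L, sInf S ∈ L

/-- The smallest subspace lattice containing a given set of closed subspaces. -/
def generate (G : Set (ClosedSubmodule ℂ H)) : Set (ClosedSubmodule ℂ H) :=
  {E | ∀ L : Set (ClosedSubmodule ℂ H), IsSubspaceLattice L → G ⊆ L → E ∈ L}

/-- `Alg L`: the bounded operators leaving every member of `L` invariant. -/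
def Alg (L : Set (ClosedSubmodule ℂ H)) : Subalgebra ℂ (H →L[ℂ] H) where
  carrier := {A | ∀ E ∈ L, ∀ x ∈ E, A x ∈ E}
  mul_mem' := fun ha hb E hE x hx => ha E hE _ (hb E hE x hx)
  add_mem' := fun ha hb E hE x hx => E.add_mem (ha E hE x hx) (hb E hE x hx)
  algebraMap_mem' := fun c E _ x hx => by
    simpa [Algebra.algebraMap_eq_smul_one] using E.smul_mem c hx

/-- `Lat 𝒜`: the closed subspaces left invariant by every operator in `𝒜`. -/
def Lat (𝒜 : Subalgebra ℂ (H →L[ℂ] H)) : Set (ClosedSubmodule ℂ H) :=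
  {E | ∀ A ∈ 𝒜, ∀ x ∈ E, A x ∈ E}

/-- A set of closed subspaces is reflexive if it equals `Lat (Alg L)`. -/
def IsReflexive (L : Set (ClosedSubmodule ℂ H)) : Prop :=
  L = Lat (Alg L)

/-- The operator `T` has rank one. -/
def IsRankOne (T : H →L[ℂ] H) : Prop :=
  Module.finrank ℂ (LinearMap.range (T : H →ₗ[ℂ] H)) = 1

/-- The operator `T` has finite rank. -/
def IsFiniteRank (T : H →L[ℂ] H) : Prop :=
  FiniteDimensional ℂ (LinearMap.range (T : H →ₗ[ℂ] H))

/-- The linear span of the idempotents of `𝒜`. -/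
def idempotentSpan (𝒜 : Subalgebra ℂ (H →L[ℂ] H)) : Submodule ℂ (H →L[ℂ] H) :=
  Submodule.span ℂ {T | T ∈ 𝒜 ∧ IsIdempotentElem T}

/-- The linear span of the rank-one operators of `𝒜`. -/
def rankOneSpan (𝒜 : Subalgebra ℂ (H →L[ℂ] H)) : Submodule ℂ (H →L[ℂ] H) :=
  Submodule.span ℂ {T | T ∈ 𝒜 ∧ IsRankOne T}

/-- `𝒜` is decomposable: every finite-rank operator in `𝒜` is a (possibly empty) finite sum of
rank-one operators belonging to `𝒜`. -/
def IsDecomposable (𝒜 : Subalgebra ℂ (H →L[ℂ] H)) : Prop :=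
  ∀ T ∈ 𝒜, IsFiniteRank T →
    ∃ (m : ℕ) (R : Fin m → (H →L[ℂ] H)), (∀ i, R i ∈ 𝒜 ∧ IsRankOne (R i)) ∧ T = ∑ i, R i

/-- A derivation from `𝒜` into `B(H)`; no continuity is required. -/
def IsDerivation {𝒜 : Subalgebra ℂ (H →L[ℂ] H)} (D : 𝒜 →ₗ[ℂ] (H →L[ℂ] H)) : Prop :=
  ∀ A B : 𝒜, D (A * B) = D A * (B : H →L[ℂ] H) + (A : H →L[ℂ] H) * D B

/-- A (linear) local derivation from `𝒜` into `B(H)`: at each `A` it agrees with some derivation,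
which may depend on `A`. -/
def IsLocalDerivation {𝒜 : Subalgebra ℂ (H →L[ℂ] H)} (δ : 𝒜 →ₗ[ℂ] (H →L[ℂ] H)) : Prop :=
  ∀ A : 𝒜, ∃ D : 𝒜 →ₗ[ℂ] (H →L[ℂ] H), IsDerivation D ∧ δ A = D A

end General

section DirectSum

/-- The Hilbert space direct sum of copies of `H` indexed by `ι` (square-summable families); it is
used for `ι = Fin n` and for `ι = ℕ`. -/
abbrev Copies (ι : Type*) (H : Type*) [NormedAddCommGroup H] : Type _ :=
  lp (fun _ : ι => H) 2

variable {ι : Type*} [LinearOrder ι]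
variable {H : Type*} [NormedAddCommGroup H] [InnerProductSpace ℂ H]

/-- The subspace of all `v` whose coordinates beyond `k` vanish, i.e. the range of
`∑_{j ≤ k} E_{jj} ⊗ I`. -/
def initial (k : ι) : ClosedSubmodule ℂ (Copies ι H) :=
  ⨅ j : {j : ι // k < j},
    (⊥ : ClosedSubmodule ℂ H).comap (lp.evalCLM ℂ (fun _ : ι => H) 2 (j : ι))

theorem mem_initial {k : ι} {v : Copies ι H} :
    v ∈ (initial k : ClosedSubmodule ℂ (Copies ι H)) ↔ ∀ j, k < j → v j = 0 := by
  simp only [initial, ClosedSubmodule.mem_iInf, ClosedSubmodule.mem_comap,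
    ClosedSubmodule.mem_bot, Subtype.forall]
  rfl

/-- The copy of `P` in the first summand, i.e. the range of `E_{11} ⊗ P`. -/
def firstCopy [OrderBot ι] (P : ClosedSubmodule ℂ H) : ClosedSubmodule ℂ (Copies ι H) :=
  P.comap (lp.evalCLM ℂ (fun _ : ι => H) 2 (⊥ : ι)) ⊓ initial (⊥ : ι)

theorem mem_firstCopy [OrderBot ι] {P : ClosedSubmodule ℂ H} {v : Copies ι H} :
    v ∈ (firstCopy P : ClosedSubmodule ℂ (Copies ι H)) ↔
      v (⊥ : ι) ∈ P ∧ ∀ j, j ≠ (⊥ : ι) → v j = 0 := by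
  simp only [firstCopy, ClosedSubmodule.mem_inf, ClosedSubmodule.mem_comap, mem_initial,
    bot_lt_iff_ne_bot]
  rfl

/-- The range of the projection `Q_ζ`: the closed subspace spanned by the vectors `(ζ_i x)_i`,
`x ∈ H`. -/
def diagonal (H : Type*) [NormedAddCommGroup H] [InnerProductSpace ℂ H] {ι : Type*}
    (ζ : Copies ι ℂ) : ClosedSubmodule ℂ (Copies ι H) :=
  (Submodule.span ℂ {v : Copies ι H | ∃ x : H, ∀ i, v i = ζ i • x}).closure

/-- The lattice generated by the subspaces `E_{11} ⊗ P` (`P ∈ L₀`), `Q_ζ`, and `F_k` for every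
index `k` other than the first. -/
def extend [OrderBot ι] (ζ : Copies ι ℂ) (L₀ : Set (ClosedSubmodule ℂ H)) :
    Set (ClosedSubmodule ℂ (Copies ι H)) :=
  generate ((firstCopy '' L₀ ∪ {diagonal H ζ}) ∪ initial '' {k : ι | k ≠ ⊥})

end DirectSum

end SubspaceLattice

end

/-! A local derivation `δ` satisfies `A * δ B * C = 0` whenever `A * B = 0 = B * C`. Applying this to
`p` and `1 - p`, `q` and `1 - q`, for idempotents `p` and `q` gives
`δ (p A q) = p δ (A q) + δ (p A) q - p δ A q`, and both sides are linear in `p` and in `q`; hence the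
identity holds for all `p`, `q` in the linear span of the idempotents
(`IsLocalDerivation.map_mul_mul`). It remains to see that every finite-rank operator of the extended
algebra lies in the span of its idempotents.

Let `T` be such an operator. Suppose first that the range of `T` lies in `initial k` for an index `k`
which is not the last one. A nonzero vector of the diagonal has no vanishing coordinate, so `T`
kills the diagonal. Consequently each row of `T` again belongs to the algebra, and `T` is the sum of
its rows of index `i ≤ k`. If `A` is the diagonal entry of the `i`-th row and `i < j`, the embedding
`φ A = E_{ii} ⊗ A - (ζ i / ζ j) E_{ij} ⊗ A` is multiplicative and takes values in the extended
algebra, so `φ A` is a combination of idempotents because `A` is: for the first row this is the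
hypothesis on `L₀`, for the other rows it holds since `A` is an arbitrary finite-rank operator. The
rest `R` of the row satisfies `φ 1 * R = R` and `R * φ 1 = R * R = 0`, so that `R = (φ 1 + R) - φ 1`
is a difference of idempotents (`mem_idempotentSpan_of_row`).

For finitely many copies, the general case is reduced to this one by subtracting the operator that
agrees with `T` on the diagonal and kills every vector with vanishing last coordinate. For
infinitely many copies, nothing needs to be subtracted: the range of `T` is the increasing union of
the finite-dimensional spaces `T (initial k)`, hence equals one of them. -/

noncomputable section

namespace SubspaceLattice

/-! ### Local derivations and idempotents -/

section LocalDerivation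

variable {H : Type*} [NormedAddCommGroup H] [InnerProductSpace ℂ H]
variable {𝒜 : Subalgebra ℂ (H →L[ℂ] H)}

theorem IsLocalDerivation.mul_mul_eq_zero {δ : 𝒜 →ₗ[ℂ] (H →L[ℂ] H)} (hδ : IsLocalDerivation δ)
    {A B C : 𝒜} (hAB : A * B = 0) (hBC : B * C = 0) : A.1 * δ B * C.1 = 0 := by
  obtain ⟨D, hD, hB⟩ := hδ B
  have h₁ := hD A B
  have h₂ := hD B C
  rw [hAB, map_zero] at h₁
  rw [hBC, map_zero] at h₂
  have hBC' : B.1 * C.1 = 0 := congrArg Subtype.val hBC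
  calc A.1 * δ B * C.1 = (D A * B.1 + A.1 * D B) * C.1 - D A * (B.1 * C.1) := by
        rw [hB]; noncomm_ring
    _ = 0 := by rw [← h₁, hBC']; simp

theorem IsLocalDerivation.map_mul_mul_of_isIdempotentElem {δ : 𝒜 →ₗ[ℂ] (H →L[ℂ] H)}
    (hδ : IsLocalDerivation δ) (A : 𝒜) {p q : 𝒜} (hp : IsIdempotentElem p)
    (hq : IsIdempotentElem q) :
    δ (p * A * q) = p.1 * δ (A * q) + δ (p * A) * q.1 - p.1 * δ A * q.1 := by
  have hp₁ : (1 - p) * p = 0 := by rw [sub_mul, one_mul, hp.eq, sub_self]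
  have hp₂ : p * (1 - p) = 0 := by rw [mul_sub, mul_one, hp.eq, sub_self]
  have hq₁ : (1 - q) * q = 0 := by rw [sub_mul, one_mul, hq.eq, sub_self]
  have hq₂ : q * (1 - q) = 0 := by rw [mul_sub, mul_one, hq.eq, sub_self]
  have e₁ := hδ.mul_mul_eq_zero (A := 1 - p) (B := p * A * q) (C := 1 - q)
    (by rw [mul_assoc p, ← mul_assoc, hp₁, zero_mul]) (by rw [mul_assoc, hq₂, mul_zero])
  have e₂ := hδ.mul_mul_eq_zero (A := p) (B := (1 - p) * A * q) (C := 1 - q)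
    (by rw [mul_assoc (1 - p), ← mul_assoc, hp₂, zero_mul]) (by rw [mul_assoc, hq₂, mul_zero])
  have e₃ := hδ.mul_mul_eq_zero (A := 1 - p) (B := p * A * (1 - q)) (C := q)
    (by rw [mul_assoc p, ← mul_assoc, hp₁, zero_mul]) (by rw [mul_assoc, hq₁, mul_zero])
  have e₄ := hδ.mul_mul_eq_zero (A := p) (B := (1 - p) * A * (1 - q)) (C := q)
    (by rw [mul_assoc (1 - p), ← mul_assoc, hp₂, zero_mul]) (by rw [mul_assoc, hq₁, mul_zero])
  have x₂ : (1 - p) * A * q = A * q - p * A * q := by rw [sub_mul, sub_mul, one_mul]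
  have x₃ : p * A * (1 - q) = p * A - p * A * q := by rw [mul_sub, mul_one]
  have x₄ : (1 - p) * A * (1 - q) = A - A * q - p * A + p * A * q := by
    simp only [sub_mul, mul_sub, one_mul, mul_one]
    abel
  have hv (r : 𝒜) : ((1 - r : 𝒜) : H →L[ℂ] H) = 1 - r.1 := rfl
  rw [hv, hv] at e₁
  rw [x₂, map_sub, hv] at e₂
  rw [x₃, map_sub, hv] at e₃
  rw [x₄, map_add, map_sub, map_sub] at e₄
  rw [← sub_eq_zero]
  calc _ = (1 - p.1) * δ (p * A * q) * (1 - q.1) - p.1 * (δ (A * q) - δ (p * A * q)) * (1 - q.1)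
        - (1 - p.1) * (δ (p * A) - δ (p * A * q)) * q.1
        + p.1 * (δ A - δ (A * q) - δ (p * A) + δ (p * A * q)) * q.1 := by noncomm_ring
    _ = 0 := by rw [e₁, e₂, e₃, e₄]; simp

theorem idempotentSpan_eq_map (𝒜 : Subalgebra ℂ (H →L[ℂ] H)) :
    idempotentSpan 𝒜 =
      (Submodule.span ℂ {p : 𝒜 | IsIdempotentElem p}).map 𝒜.val.toLinearMap := by
  rw [Submodule.map_span, idempotentSpan]
  congr 1
  ext T
  constructor
  · rintro ⟨hT, hi⟩
    exact ⟨⟨T, hT⟩, Subtype.ext hi.eq, rfl⟩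
  · rintro ⟨p, hp, rfl⟩
    exact ⟨p.2, congrArg Subtype.val hp.eq⟩

theorem mem_span_of_mem_idempotentSpan {M : 𝒜} (hM : M.1 ∈ idempotentSpan 𝒜) :
    M ∈ Submodule.span ℂ {p : 𝒜 | IsIdempotentElem p} := by
  rw [idempotentSpan_eq_map] at hM
  obtain ⟨M', hM', h⟩ := hM
  rwa [← Subtype.ext h]

theorem IsLocalDerivation.map_mul_mul {δ : 𝒜 →ₗ[ℂ] (H →L[ℂ] H)} (hδ : IsLocalDerivation δ)
    (A : 𝒜) {M N : 𝒜} (hM : M.1 ∈ idempotentSpan 𝒜) (hN : N.1 ∈ idempotentSpan 𝒜) :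
    δ (M * A * N) = M.1 * δ (A * N) + δ (M * A) * N.1 - M.1 * δ A * N.1 := by
  replace hM := mem_span_of_mem_idempotentSpan hM
  replace hN := mem_span_of_mem_idempotentSpan hN
  induction hM, hN using
    Submodule.span_induction₂ with
  | mem_mem p q hp hq => exact hδ.map_mul_mul_of_isIdempotentElem A hp hq
  | zero_left q hq => simp
  | zero_right p hp => simp
  | add_left p p' q _ _ _ h h' =>
    simp only [add_mul, map_add, AddMemClass.coe_add, h, h']
    abel
  | add_right p q q' _ _ _ h h' =>
    simp only [mul_add, map_add, AddMemClass.coe_add, h, h']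
    abel
  | smul_left c p q _ _ h =>
    simp only [smul_mul_assoc, map_smul, SetLike.val_smul, h, smul_add, smul_sub]
  | smul_right c p q _ _ h =>
    simp only [mul_smul_comm, map_smul, SetLike.val_smul, h, smul_add, smul_sub]

end LocalDerivation

/-! ### Finite-rank operators and spans of idempotents -/

section FiniteRank

variable {H K : Type*} [NormedAddCommGroup H] [InnerProductSpace ℂ H]
  [NormedAddCommGroup K] [InnerProductSpace ℂ K]

theorem IsFiniteRank.comp_comp {T : K →L[ℂ] K} (hT : IsFiniteRank T) (B : K →L[ℂ] H)
    (C : H →L[ℂ] K) : IsFiniteRank (B ∘L T ∘L C) := by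
  have : FiniteDimensional ℂ (LinearMap.range (T : K →ₗ[ℂ] K)) := hT
  refine Submodule.finiteDimensional_of_le
    (S₂ := (LinearMap.range (T : K →ₗ[ℂ] K)).map (B : K →ₗ[ℂ] H)) ?_
  rintro _ ⟨x, rfl⟩
  exact ⟨T (C x), ⟨C x, rfl⟩, rfl⟩

theorem IsFiniteRank.sub {S T : H →L[ℂ] H} (hS : IsFiniteRank S) (hT : IsFiniteRank T) :
    IsFiniteRank (S - T) := by
  have : FiniteDimensional ℂ (LinearMap.range (S : H →ₗ[ℂ] H)) := hS
  have : FiniteDimensional ℂ (LinearMap.range (T : H →ₗ[ℂ] H)) := hT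
  refine Submodule.finiteDimensional_of_le
    (S₂ := LinearMap.range (S : H →ₗ[ℂ] H) ⊔ LinearMap.range (T : H →ₗ[ℂ] H)) ?_
  rintro _ ⟨x, rfl⟩
  exact Submodule.sub_mem _ (Submodule.mem_sup_left ⟨x, rfl⟩) (Submodule.mem_sup_right ⟨x, rfl⟩)

/-- A rank-one operator of nonzero trace is a multiple of an idempotent, and one of trace zero is a
difference of two idempotents. -/
theorem smulRight_mem_idempotentSpan_top (f : H →L[ℂ] ℂ) (u : H) :
    f.smulRight u ∈ idempotentSpan (⊤ : Subalgebra ℂ (H →L[ℂ] H)) := by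
  have key (w : H) (hw : f w = 1) :
      f.smulRight w ∈ idempotentSpan (⊤ : Subalgebra ℂ (H →L[ℂ] H)) := by
    refine Submodule.subset_span ⟨trivial, ?_⟩
    ext x
    simp [hw]
  obtain rfl | hf := eq_or_ne f 0
  · simp
  obtain ⟨w, hw⟩ : ∃ w, f w ≠ 0 := by
    by_contra! h
    exact hf (ContinuousLinearMap.ext h)
  have hw' : f ((f w)⁻¹ • w) = 1 := by simp [hw]
  by_cases hu : f u = 0
  · have h := Submodule.sub_mem _ (key (u + (f w)⁻¹ • w) (by rw [map_add, hu, hw', zero_add]))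
      (key _ hw')
    convert h using 1
    ext x
    simp
  · have h := Submodule.smul_mem _ (f u) (key ((f u)⁻¹ • u) (by simp [hu]))
    convert h using 1
    ext x
    change f x • u = f u • f x • (f u)⁻¹ • u
    rw [smul_comm (f x), smul_inv_smul₀ hu]

theorem IsFiniteRank.mem_idempotentSpan_top {T : H →L[ℂ] H} (hT : IsFiniteRank T) :
    T ∈ idempotentSpan (⊤ : Subalgebra ℂ (H →L[ℂ] H)) := by
  have : FiniteDimensional ℂ (LinearMap.range (T : H →ₗ[ℂ] H)) := hT
  let b := stdOrthonormalBasis ℂ (LinearMap.range (T : H →ₗ[ℂ] H))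
  have h : T = ∑ i, ((innerSL ℂ (b i : H)) ∘L T).smulRight (b i : H) := by
    ext x
    have hx := congrArg Subtype.val (b.sum_repr' ⟨T x, ⟨x, rfl⟩⟩)
    simp only [Submodule.coe_sum, Submodule.coe_smul, Submodule.coe_inner] at hx
    rw [sum_apply]
    exact hx.symm
  rw [h]
  exact Submodule.sum_mem _ fun i _ => smulRight_mem_idempotentSpan_top _ _

/-- If `l` is a left inverse of `u`, then `A ↦ u A l` is multiplicative, so it preserves
combinations of idempotents. -/
theorem comp_comp_mem_idempotentSpan {𝒜 : Subalgebra ℂ (H →L[ℂ] H)}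
    {ℬ : Subalgebra ℂ (K →L[ℂ] K)} {u : H →L[ℂ] K} {l : K →L[ℂ] H} (hlu : ∀ x, l (u x) = x)
    (hmem : ∀ A ∈ 𝒜, u ∘L A ∘L l ∈ ℬ) {A : H →L[ℂ] H} (hA : A ∈ idempotentSpan 𝒜) :
    u ∘L A ∘L l ∈ idempotentSpan ℬ := by
  induction hA using Submodule.span_induction with
  | mem p hp =>
    refine Submodule.subset_span ⟨hmem p hp.1, ?_⟩
    ext v
    simpa [hlu] using congrArg u (DFunLike.congr_fun hp.2.eq (l v))
  | zero => simp
  | add p q _ _ hp hq =>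
    simpa only [ContinuousLinearMap.add_comp, ContinuousLinearMap.comp_add] using
      Submodule.add_mem _ hp hq
  | smul c p _ hp =>
    simpa only [ContinuousLinearMap.smul_comp, ContinuousLinearMap.comp_smul] using
      Submodule.smul_mem _ c hp

/-- If `p` and `p + R` are idempotents, then `R` is a combination of idempotents. -/
theorem mem_idempotentSpan_of_mul_eq {𝒜 : Subalgebra ℂ (H →L[ℂ] H)} {p R : H →L[ℂ] H}
    (hp : p ∈ 𝒜) (hR : R ∈ 𝒜) (hpp : p * p = p) (hpR : p * R = R) (hRp : R * p = 0)
    (hRR : R * R = 0) : R ∈ idempotentSpan 𝒜 := by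
  have h := Submodule.sub_mem (idempotentSpan 𝒜)
    (Submodule.subset_span ⟨𝒜.add_mem hp hR, by
      rw [IsIdempotentElem, mul_add, add_mul, add_mul, hpp, hpR, hRp, hRR, add_zero, add_zero]⟩)
    (Submodule.subset_span ⟨hp, hpp⟩)
  rwa [add_sub_cancel_left] at h

end FiniteRank

/-! ### The algebra of the extended lattice -/

section Extend

variable {H : Type*} [NormedAddCommGroup H] [InnerProductSpace ℂ H]

theorem isSubspaceLattice_invariant (T : H →L[ℂ] H) :
    IsSubspaceLattice {E : ClosedSubmodule ℂ H | ∀ x ∈ E, T x ∈ E} where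
  bot_mem := fun x hx => by
    rw [ClosedSubmodule.mem_bot] at hx ⊢
    rw [hx, map_zero]
  top_mem := fun _ _ => ClosedSubmodule.mem_top
  sSup_mem := fun S hS => by
    have h : sSup S ≤ (sSup S).comap T :=
      sSup_le fun E hE x hx => (le_sSup hE : E ≤ sSup S) (hS hE x hx)
    exact fun x hx => h hx
  sInf_mem := fun S hS x hx => by
    rw [ClosedSubmodule.mem_sInf] at hx ⊢
    exact fun E hE => hS hE x (hx E hE)

theorem mem_Alg_generate {G : Set (ClosedSubmodule ℂ H)} {T : H →L[ℂ] H} :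
    T ∈ Alg (generate G) ↔ ∀ E ∈ G, ∀ x ∈ E, T x ∈ E :=
  ⟨fun hT E hE => hT E fun _ _ hG => hG hE,
    fun hT _ hE => hE _ (isSubspaceLattice_invariant T) hT⟩

variable {ι : Type*} [LinearOrder ι]

/-- The `i`-th coordinate of a vector of the direct sum. -/
abbrev coord (H : Type*) [NormedAddCommGroup H] [InnerProductSpace ℂ H] {ι : Type*} (i : ι) :
    Copies ι H →L[ℂ] H :=
  lp.evalCLM ℂ (fun _ : ι => H) 2 i

/-- The embedding of `H` as the `i`-th summand. -/
abbrev incl (H : Type*) [NormedAddCommGroup H] [InnerProductSpace ℂ H] (i : ι) :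
    H →L[ℂ] Copies ι H :=
  lp.singleContinuousLinearMap ℂ (fun _ : ι => H) 2 i

theorem incl_apply_self (i : ι) (x : H) : incl H i x i = x := lp.single_apply_self (E := fun _ : ι => H) 2 i x

theorem incl_apply_of_ne {i j : ι} (h : j ≠ i) (x : H) : incl H i x j = 0 :=
  lp.single_apply_ne (E := fun _ : ι => H) 2 i x h

theorem incl_mem_initial {i k : ι} (hik : i ≤ k) (x : H) :
    incl H i x ∈ (initial k : ClosedSubmodule ℂ (Copies ι H)) :=
  mem_initial.2 fun _ hj => incl_apply_of_ne (hik.trans_lt hj).ne' x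

theorem smul_apply_eq_of_mem_diagonal {ι : Type*} {ζ : Copies ι ℂ} {v : Copies ι H}
    (hv : v ∈ diagonal H ζ) (i j : ι) : ζ i • v j = ζ j • v i := by
  have h : diagonal H ζ ≤
      (⊥ : ClosedSubmodule ℂ H).comap (ζ i • coord H j - ζ j • coord H i) := by
    refine Submodule.closure_le.2 (Submodule.span_le.2 ?_)
    rintro w ⟨x, hx⟩
    change ζ i • w j - ζ j • w i = 0
    rw [hx, hx, smul_smul, smul_smul, mul_comm, sub_self]
  exact sub_eq_zero.1 (h hv)

theorem eq_zero_of_mem_diagonal {ι : Type*} {ζ : Copies ι ℂ} {v : Copies ι H}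
    (hv : v ∈ diagonal H ζ) {j : ι} (hζ : ζ j ≠ 0) (hj : v j = 0) : v = 0 := by
  ext i
  have h := smul_apply_eq_of_mem_diagonal hv i j
  rw [hj, smul_zero] at h
  exact (smul_eq_zero.1 h.symm).resolve_left hζ

theorem mem_diagonal {ι : Type*} {ζ : Copies ι ℂ} {v : Copies ι H} (x : H)
    (hv : ∀ i, v i = ζ i • x) : v ∈ diagonal H ζ :=
  Submodule.closure_le.1 le_rfl (Submodule.subset_span ⟨x, hv⟩)

variable [OrderBot ι] {L₀ : Set (ClosedSubmodule ℂ H)} {ζ : Copies ι ℂ}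
  {T : Copies ι H →L[ℂ] Copies ι H}

theorem mem_Alg_extend (h₁ : ∀ P ∈ L₀, ∀ v ∈ firstCopy (ι := ι) P, T v ∈ firstCopy (ι := ι) P)
    (h₂ : ∀ v ∈ diagonal H ζ, T v ∈ diagonal H ζ)
    (h₃ : ∀ k, k ≠ ⊥ → ∀ v ∈ (initial k : ClosedSubmodule ℂ (Copies ι H)),
      T v ∈ (initial k : ClosedSubmodule ℂ (Copies ι H))) :
    T ∈ Alg (extend ζ L₀) := by
  refine mem_Alg_generate.2 ?_
  rintro E ((⟨P, hP, rfl⟩ | rfl) | ⟨k, hk, rfl⟩)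
  exacts [h₁ P hP, h₂, h₃ k hk]

theorem apply_mem_firstCopy (hT : T ∈ Alg (extend ζ L₀)) {P : ClosedSubmodule ℂ H} (hP : P ∈ L₀)
    {v : Copies ι H} (hv : v ∈ firstCopy (ι := ι) P) : T v ∈ firstCopy (ι := ι) P :=
  mem_Alg_generate.1 hT _ (.inl (.inl ⟨P, hP, rfl⟩)) v hv

theorem apply_mem_diagonal (hT : T ∈ Alg (extend ζ L₀)) {v : Copies ι H}
    (hv : v ∈ diagonal H ζ) : T v ∈ diagonal H ζ :=
  mem_Alg_generate.1 hT _ (.inl (.inr rfl)) v hv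

theorem apply_mem_initial (hL₀ : ⊤ ∈ L₀) (hT : T ∈ Alg (extend ζ L₀)) {k : ι} {v : Copies ι H}
    (hv : v ∈ (initial k : ClosedSubmodule ℂ (Copies ι H))) :
    T v ∈ (initial k : ClosedSubmodule ℂ (Copies ι H)) := by
  obtain rfl | hk := eq_or_ne k ⊥
  · -- `initial ⊥` is not among the generators of that form, but it is the first copy of `⊤`.
    have h {w : Copies ι H} : w ∈ (initial ⊥ : ClosedSubmodule ℂ (Copies ι H)) ↔
        w ∈ firstCopy (ι := ι) (⊤ : ClosedSubmodule ℂ H) := by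
      simp [mem_firstCopy, mem_initial, bot_lt_iff_ne_bot]
    exact h.2 (apply_mem_firstCopy hT hL₀ (h.1 hv))
  · exact mem_Alg_generate.1 hT _ (.inr ⟨k, hk, rfl⟩) v hv

/-- If `T` has range in `initial k` and `k` is not the last index, then `T` kills the diagonal. -/
theorem apply_eq_zero_of_mem_diagonal (hT : T ∈ Alg (extend ζ L₀)) {k j : ι} (hkj : k < j)
    (hζ : ζ j ≠ 0) (hr : ∀ v, T v ∈ (initial k : ClosedSubmodule ℂ (Copies ι H)))
    {v : Copies ι H} (hv : v ∈ diagonal H ζ) : T v = 0 :=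
  eq_zero_of_mem_diagonal (apply_mem_diagonal hT hv) hζ (mem_initial.1 (hr v) j hkj)

/-- Each row of an operator of the algebra that kills the diagonal belongs to the algebra. -/
theorem row_mem_Alg (hT : T ∈ Alg (extend ζ L₀)) (hL₀ : ⊤ ∈ L₀)
    (hk : ∀ v ∈ diagonal H ζ, T v = 0) (i : ι) :
    incl H i ∘L coord H i ∘L T ∈ Alg (extend ζ L₀) := by
  have happ (v) : (incl H i ∘L coord H i ∘L T) v = incl H i (T v i) := rfl
  refine mem_Alg_extend (fun P hP v hv => ?_) (fun v hv => ?_) fun k _ v hv => ?_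
  · obtain ⟨h₁, h₂⟩ := mem_firstCopy.1 (apply_mem_firstCopy hT hP hv)
    rw [happ]
    obtain rfl | hi := eq_or_ne i ⊥
    · exact mem_firstCopy.2 ⟨by rwa [incl_apply_self], fun j hj => incl_apply_of_ne hj _⟩
    · rw [h₂ i hi, map_zero]
      exact zero_mem _
  · rw [happ, hk v hv, lp.coeFn_zero, Pi.zero_apply, map_zero]
    exact zero_mem _
  · rw [happ]
    obtain hik | hki := le_or_gt i k
    · exact incl_mem_initial hik _
    · rw [mem_initial.1 (apply_mem_initial hL₀ hT hv) i hki, map_zero]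
      exact zero_mem _

/-- The `H`-valued linear map `v ↦ v i - (ζ i / ζ j) • v j`; it kills the diagonal when `ζ j ≠ 0`.
-/
def rowCoord (H : Type*) [NormedAddCommGroup H] [InnerProductSpace ℂ H] {ι : Type*}
    (ζ : Copies ι ℂ) (i j : ι) : Copies ι H →L[ℂ] H :=
  coord H i - (ζ i / ζ j) • coord H j

theorem rowCoord_apply {ι : Type*} (ζ : Copies ι ℂ) (i j : ι) (v : Copies ι H) :
    rowCoord H ζ i j v = v i - (ζ i / ζ j) • v j := rfl

omit [OrderBot ι] in
theorem rowCoord_incl {i j : ι} (hij : i < j) (x : H) : rowCoord H ζ i j (incl H i x) = x := by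
  rw [rowCoord_apply, incl_apply_self, incl_apply_of_ne hij.ne', smul_zero, sub_zero]

/-- The operator `E_{ii} ⊗ A - (ζ i / ζ j) E_{ij} ⊗ A` belongs to the algebra; the operator `A` is
arbitrary unless `i` is the first index. -/
theorem incl_comp_rowCoord_mem_Alg {i j : ι} (hij : i < j) (hζ : ζ j ≠ 0) {A : H →L[ℂ] H}
    (hA : i = ⊥ → A ∈ Alg L₀) : incl H i ∘L A ∘L rowCoord H ζ i j ∈ Alg (extend ζ L₀) := by
  have happ (v) : (incl H i ∘L A ∘L rowCoord H ζ i j) v = incl H i (A (v i - (ζ i / ζ j) • v j)) :=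
    rfl
  refine mem_Alg_extend (fun P hP v hv => ?_) (fun v hv => ?_) fun k _ v hv => ?_
  · obtain ⟨h₁, h₂⟩ := mem_firstCopy.1 hv
    rw [happ, h₂ j (bot_le.trans_lt hij).ne', smul_zero, sub_zero]
    obtain rfl | hi := eq_or_ne i ⊥
    · exact mem_firstCopy.2 ⟨by rw [incl_apply_self]; exact hA rfl P hP _ h₁,
        fun j hj => incl_apply_of_ne hj _⟩
    · rw [h₂ i hi, map_zero, map_zero]
      exact zero_mem _
  · have h : v i = (ζ i / ζ j) • v j := by
      rw [div_eq_inv_mul, mul_smul, smul_apply_eq_of_mem_diagonal hv i j, inv_smul_smul₀ hζ]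
    rw [happ, h, sub_self, map_zero, map_zero]
    exact zero_mem _
  · rw [happ]
    obtain hik | hki := le_or_gt i k
    · exact incl_mem_initial hik _
    · rw [mem_initial.1 hv i hki, mem_initial.1 hv j (hki.trans hij), smul_zero, sub_zero,
        map_zero, map_zero]
      exact zero_mem _

/-- The first diagonal entry of an operator of the extended algebra belongs to `Alg L₀`. -/
theorem coord_comp_incl_bot_mem_Alg (hT : T ∈ Alg (extend ζ L₀)) :
    coord H ⊥ ∘L T ∘L incl H ⊥ ∈ Alg L₀ := fun _ hP x hx =>
  (mem_firstCopy.1 (apply_mem_firstCopy hT hP (v := incl H ⊥ x) (mem_firstCopy.2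
    ⟨by rwa [incl_apply_self], fun _ hj => incl_apply_of_ne hj x⟩))).1

end Extend

/-! ### Finite-rank operators of the extended algebra -/

section Span

variable {H : Type*} [NormedAddCommGroup H] [InnerProductSpace ℂ H]
  {ι : Type*} [LinearOrder ι] [OrderBot ι] {L₀ : Set (ClosedSubmodule ℂ H)} {ζ : Copies ι ℂ}
  {T : Copies ι H →L[ℂ] Copies ι H}

/-- A finite-rank operator of the algebra that is concentrated in a row other than the last is
a combination of idempotents. -/
theorem mem_idempotentSpan_of_row
    (hfin : ∀ A ∈ Alg L₀, IsFiniteRank A → A ∈ idempotentSpan (Alg L₀))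
    {i j : ι} (hij : i < j) (hζ : ζ j ≠ 0) (hT : T ∈ Alg (extend ζ L₀)) (hTf : IsFiniteRank T)
    (hrow : ∀ v, incl H i (T v i) = T v) : T ∈ idempotentSpan (Alg (extend ζ L₀)) := by
  set A : H →L[ℂ] H := coord H i ∘L T ∘L incl H i with hA
  have hAf : IsFiniteRank A := hTf.comp_comp _ _
  have hAT (x : H) : incl H i (A x) = T (incl H i x) := hrow _
  have hAmem : i = ⊥ → A ∈ Alg L₀ := by
    rintro rfl
    exact coord_comp_incl_bot_mem_Alg hT
  have hφA : incl H i ∘L A ∘L rowCoord H ζ i j ∈ idempotentSpan (Alg (extend ζ L₀)) := by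
    by_cases hi : i = ⊥
    · exact comp_comp_mem_idempotentSpan (rowCoord_incl hij)
        (fun B hB => incl_comp_rowCoord_mem_Alg hij hζ fun _ => hB) (hfin A (hAmem hi) hAf)
    · exact comp_comp_mem_idempotentSpan (rowCoord_incl hij)
        (fun B _ => incl_comp_rowCoord_mem_Alg hij hζ fun h => absurd h hi)
        hAf.mem_idempotentSpan_top
  set R := T - incl H i ∘L A ∘L rowCoord H ζ i j with hR
  have hRrow (v) : incl H i (R v i) = R v := by
    have h : R v i = T v i - A (rowCoord H ζ i j v) :=
      congrArg (T v i - ·) (incl_apply_self i (A (rowCoord H ζ i j v)))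
    rw [h, map_sub, hrow]
    rfl
  have hRincl (x : H) : R (incl H i x) = 0 := by
    change T (incl H i x) - incl H i (A (rowCoord H ζ i j (incl H i x))) = 0
    rw [rowCoord_incl hij, hAT, sub_self]
  have hRspan : R ∈ idempotentSpan (Alg (extend ζ L₀)) := by
    refine mem_idempotentSpan_of_mul_eq
      (p := incl H i ∘L (1 : H →L[ℂ] H) ∘L rowCoord H ζ i j)
      (incl_comp_rowCoord_mem_Alg hij hζ fun _ => one_mem _)
      (sub_mem hT (incl_comp_rowCoord_mem_Alg hij hζ hAmem)) ?_ ?_ ?_ ?_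
    · refine ContinuousLinearMap.ext fun v => ?_
      exact congrArg (incl H i) (rowCoord_incl hij _)
    · refine ContinuousLinearMap.ext fun v => ?_
      change incl H i (rowCoord H ζ i j (R v)) = R v
      rw [← hRrow v, rowCoord_incl hij]
    · exact ContinuousLinearMap.ext fun v => hRincl _
    · refine ContinuousLinearMap.ext fun v => ?_
      change R (R v) = 0
      rw [← hRrow v, hRincl]
  have h := add_mem hRspan hφA
  rwa [hR, sub_add_cancel] at h

/-- A finite-rank operator of the algebra with range in `initial k`, where `k` is not the last
index, is a combination of idempotents. -/
theorem mem_idempotentSpan_of_range_le_initial [LocallyFiniteOrderBot ι] (hL₀ : ⊤ ∈ L₀)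
    (hfin : ∀ A ∈ Alg L₀, IsFiniteRank A → A ∈ idempotentSpan (Alg L₀)) {k j : ι} (hkj : k < j)
    (hζ : ζ j ≠ 0) (hT : T ∈ Alg (extend ζ L₀)) (hTf : IsFiniteRank T)
    (hr : ∀ v, T v ∈ (initial k : ClosedSubmodule ℂ (Copies ι H))) :
    T ∈ idempotentSpan (Alg (extend ζ L₀)) := by
  have hk (v) (hv : v ∈ diagonal H ζ) : T v = 0 := apply_eq_zero_of_mem_diagonal hT hkj hζ hr hv
  have hsum : T = ∑ i ∈ Finset.Iic k, incl H i ∘L coord H i ∘L T := by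
    refine ContinuousLinearMap.ext fun v => ?_
    rw [sum_apply]
    ext l
    rw [lp.coeFn_sum, Finset.sum_apply]
    change T v l = ∑ i ∈ Finset.Iic k, incl H i (T v i) l
    by_cases hl : l ≤ k
    · rw [Finset.sum_eq_single_of_mem l (Finset.mem_Iic.2 hl)
        fun i _ hi => incl_apply_of_ne hi.symm _, incl_apply_self]
    · rw [mem_initial.1 (hr v) l (not_le.1 hl), Finset.sum_eq_zero]
      intro i hi
      exact incl_apply_of_ne (by rintro rfl; exact hl (Finset.mem_Iic.1 hi)) _
  rw [hsum]
  refine Submodule.sum_mem _ fun i hi => ?_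
  refine mem_idempotentSpan_of_row hfin ((Finset.mem_Iic.1 hi).trans_lt hkj) hζ
    (row_mem_Alg hT hL₀ hk i) (hTf.comp_comp (incl H i ∘L coord H i) (.id ℂ _)) fun v => ?_
  change incl H i (incl H i (T v i) i) = incl H i (T v i)
  rw [incl_apply_self]

/-- The embedding `x ↦ (ζ i x)_i` of `H` onto the diagonal, for finitely many copies. -/
def diag (H : Type*) [NormedAddCommGroup H] [InnerProductSpace ℂ H] [Fintype ι]
    (ζ : Copies ι ℂ) : H →L[ℂ] Copies ι H :=
  ∑ i, ζ i • incl H i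

omit [OrderBot ι] in
theorem diag_apply [Fintype ι] (x : H) (i : ι) : diag H ζ x i = ζ i • x := by
  rw [diag, sum_apply, lp.coeFn_sum, Finset.sum_apply]
  change ∑ l, ζ l • incl H l x i = ζ i • x
  rw [Finset.sum_eq_single i (fun l _ hl => by rw [incl_apply_of_ne hl.symm, smul_zero])
    (fun h => absurd (Finset.mem_univ i) h), incl_apply_self]

/-- For finitely many copies with last index `j`, the operator that acts as `A` on the diagonal and
kills every vector with vanishing last coordinate belongs to the algebra. -/
theorem diag_comp_coord_mem_Alg [Fintype ι] {j : ι} (hj : j ≠ ⊥) (hmax : ∀ i, i ≤ j)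
    (A : H →L[ℂ] H) : diag H ζ ∘L A ∘L ((ζ j)⁻¹ • coord H j) ∈ Alg (extend ζ L₀) := by
  have h₀ (v : Copies ι H) (hv : v j = 0) :
      (diag H ζ ∘L A ∘L ((ζ j)⁻¹ • coord H j)) v = 0 := by
    change diag H ζ (A ((ζ j)⁻¹ • v j)) = 0
    rw [hv, smul_zero, map_zero, map_zero]
  refine mem_Alg_extend (fun P hP v hv => ?_) (fun v _ => ?_) fun k _ v hv => ?_
  · rw [h₀ v ((mem_firstCopy.1 hv).2 j hj)]
    exact zero_mem _
  · exact mem_diagonal _ fun i => diag_apply _ i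
  · obtain rfl | hk := (hmax k).eq_or_lt
    · exact mem_initial.2 fun l hl => absurd (hmax l) (not_le.2 hl)
    · rw [h₀ v (mem_initial.1 hv j hk)]
      exact zero_mem _

/-- For finitely many copies, every finite-rank operator of the algebra is a combination of
idempotents; the indices `k` and `j` are the last two. -/
theorem mem_idempotentSpan_of_finite [Fintype ι] [LocallyFiniteOrderBot ι] (hL₀ : ⊤ ∈ L₀)
    (hfin : ∀ A ∈ Alg L₀, IsFiniteRank A → A ∈ idempotentSpan (Alg L₀)) {k j : ι} (hkj : k ⋖ j)
    (hmax : ∀ i, i ≤ j) (hζ : ζ j ≠ 0) (hT : T ∈ Alg (extend ζ L₀)) (hTf : IsFiniteRank T) :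
    T ∈ idempotentSpan (Alg (extend ζ L₀)) := by
  have hj : j ≠ ⊥ := (bot_le.trans_lt hkj.lt).ne'
  set A : H →L[ℂ] H := coord H j ∘L T ∘L incl H j with hA
  have hAf : IsFiniteRank A := hTf.comp_comp _ _
  set S := diag H ζ ∘L A ∘L ((ζ j)⁻¹ • coord H j) with hS
  have hSmem : S ∈ Alg (extend ζ L₀) := diag_comp_coord_mem_Alg hj hmax A
  have hSspan : S ∈ idempotentSpan (Alg (extend ζ L₀)) := by
    refine comp_comp_mem_idempotentSpan (𝒜 := ⊤) (fun x => ?_)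
      (fun B _ => diag_comp_coord_mem_Alg hj hmax B) hAf.mem_idempotentSpan_top
    change (ζ j)⁻¹ • diag H ζ x j = x
    rw [diag_apply, inv_smul_smul₀ hζ]
  have hSf : IsFiniteRank S := by
    have h : S = (diag H ζ ∘L coord H j) ∘L T ∘L (incl H j ∘L ((ζ j)⁻¹ • coord H j)) := rfl
    rw [h]
    exact hTf.comp_comp _ _
  have hSj (v) : S v j = A (v j) := by
    change diag H ζ (A ((ζ j)⁻¹ • v j)) j = A (v j)
    rw [diag_apply, map_smul, smul_inv_smul₀ hζ]
  -- `T` is upper triangular, so the last coordinate of `T v` depends on that of `v` alone.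
  have hTj (v) : T v j = A (v j) := by
    have h₁ : v - incl H j (v j) ∈ (initial k : ClosedSubmodule ℂ (Copies ι H)) := by
      refine mem_initial.2 fun l hl => ?_
      obtain rfl := (hmax l).antisymm (hkj.ge_of_gt hl)
      exact (congrArg (v l - ·) (incl_apply_self l (v l))).trans (sub_self _)
    have h₂ := mem_initial.1 (apply_mem_initial hL₀ hT h₁) j hkj.lt
    rw [map_sub] at h₂
    exact sub_eq_zero.1 h₂
  have hspan : T - S ∈ idempotentSpan (Alg (extend ζ L₀)) := by
    refine mem_idempotentSpan_of_range_le_initial hL₀ hfin hkj.lt hζ (sub_mem hT hSmem)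
      (hTf.sub hSf) fun v => mem_initial.2 fun l hl => ?_
    obtain rfl := (hmax l).antisymm (hkj.ge_of_gt hl)
    change T v l - S v l = 0
    rw [hTj, hSj, sub_self]
  have h := add_mem hspan hSspan
  rwa [sub_add_cancel] at h

/-- A finite-rank operator of the algebra over infinitely many copies has range in some
`initial n`: the images of the subspaces `initial n` stabilize, and the union of these subspaces is
dense. -/
theorem exists_range_le_initial {η : Copies ℕ ℂ} {T : Copies ℕ H →L[ℂ] Copies ℕ H} (hL₀ : ⊤ ∈ L₀)
    (hT : T ∈ Alg (extend η L₀)) (hTf : IsFiniteRank T) :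
    ∃ n, ∀ v, T v ∈ (initial n : ClosedSubmodule ℂ (Copies ℕ H)) := by
  have : FiniteDimensional ℂ (LinearMap.range (T : Copies ℕ H →ₗ[ℂ] Copies ℕ H)) := hTf
  let f : ℕ →o Submodule ℂ (LinearMap.range (T : Copies ℕ H →ₗ[ℂ] Copies ℕ H)) :=
    { toFun := fun n => (initial n : ClosedSubmodule ℂ (Copies ℕ H)).toSubmodule.map
        (T : Copies ℕ H →ₗ[ℂ] Copies ℕ H).rangeRestrict
      monotone' := fun m n hmn => Submodule.map_mono fun v hv =>
        mem_initial.2 fun j hj => mem_initial.1 hv j (hmn.trans_lt hj) }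
  obtain ⟨n, hn⟩ := monotone_stabilizes_iff_noetherian.2
    (inferInstance : IsNoetherian ℂ (LinearMap.range (T : Copies ℕ H →ₗ[ℂ] Copies ℕ H))) f
  have key (m : ℕ) (v : Copies ℕ H) (hv : v ∈ (initial m : ClosedSubmodule ℂ (Copies ℕ H))) :
      T v ∈ (initial n : ClosedSubmodule ℂ (Copies ℕ H)) := by
    have hv' : v ∈ (initial (max n m) : ClosedSubmodule ℂ (Copies ℕ H)) :=
      mem_initial.2 fun j hj => mem_initial.1 hv j ((le_max_right n m).trans_lt hj)
    have h : (T : Copies ℕ H →ₗ[ℂ] Copies ℕ H).rangeRestrict v ∈ f n := by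
      rw [hn _ (le_max_left n m)]
      exact ⟨v, hv', rfl⟩
    obtain ⟨w, hw, hwv⟩ := h
    have hwv' : T w = T v := congrArg Subtype.val hwv
    exact hwv' ▸ apply_mem_initial hL₀ hT hw
  refine ⟨n, fun v => ?_⟩
  have hsum : HasSum (fun i => incl H i (v i)) v := lp.hasSum_single ENNReal.ofNat_ne_top v
  have hclosed := ((initial n : ClosedSubmodule ℂ (Copies ℕ H)).comap T).isClosed
  refine hclosed.mem_of_tendsto hsum (Filter.Eventually.of_forall fun s => ?_)
  exact Submodule.sum_mem ((initial n : ClosedSubmodule ℂ (Copies ℕ H)).comap T).toSubmodule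
    fun i _ => key i _ (incl_mem_initial le_rfl _)

end Span

/-- In a decomposable algebra whose rank-one operators are combinations of idempotents, so are the
finite-rank operators. -/
theorem IsDecomposable.mem_idempotentSpan {H : Type*} [NormedAddCommGroup H]
    [InnerProductSpace ℂ H] {𝒜 : Subalgebra ℂ (H →L[ℂ] H)} (hdec : IsDecomposable 𝒜)
    (hspan : rankOneSpan 𝒜 ≤ idempotentSpan 𝒜) {A : H →L[ℂ] H} (hA : A ∈ 𝒜)
    (hAf : IsFiniteRank A) : A ∈ idempotentSpan 𝒜 := by
  obtain ⟨m, R, hR, rfl⟩ := hdec A hA hAf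
  exact Submodule.sum_mem _ fun i _ => hspan (Submodule.subset_span (hR i))

end SubspaceLattice

end

theorem mainTheorem3 {H : Type*} [NormedAddCommGroup H] [InnerProductSpace ℂ H] [CompleteSpace H]
    (L₀ : Set (ClosedSubmodule ℂ H))
    (hL₀ : SubspaceLattice.IsSubspaceLattice L₀)
    (hrefl : SubspaceLattice.IsReflexive L₀)
    (hdec : SubspaceLattice.IsDecomposable (SubspaceLattice.Alg L₀))
    (hspan : SubspaceLattice.rankOneSpan (SubspaceLattice.Alg L₀) ≤
      SubspaceLattice.idempotentSpan (SubspaceLattice.Alg L₀)) :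
    (∀ (n : ℕ) [NeZero n], 2 ≤ n →
      ∀ ζ : SubspaceLattice.Copies (Fin n) ℂ, ‖ζ‖ = 1 → (∀ i, ζ i ≠ 0) →
      ∀ δ : SubspaceLattice.Alg (SubspaceLattice.extend ζ L₀) →ₗ[ℂ]
          (SubspaceLattice.Copies (Fin n) H →L[ℂ] SubspaceLattice.Copies (Fin n) H),
        SubspaceLattice.IsLocalDerivation δ →
        ∀ A M N : SubspaceLattice.Alg (SubspaceLattice.extend ζ L₀),
          SubspaceLattice.IsFiniteRank M.1 → SubspaceLattice.IsFiniteRank N.1 →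
          δ (M * A * N) = M.1 * δ (A * N) + δ (M * A) * N.1 - M.1 * δ A * N.1) ∧
    (∀ η : SubspaceLattice.Copies ℕ ℂ, ‖η‖ = 1 → (∀ i, η i ≠ 0) →
      ∀ δ : SubspaceLattice.Alg (SubspaceLattice.extend η L₀) →ₗ[ℂ]
          (SubspaceLattice.Copies ℕ H →L[ℂ] SubspaceLattice.Copies ℕ H),
        SubspaceLattice.IsLocalDerivation δ →
        ∀ A M N : SubspaceLattice.Alg (SubspaceLattice.extend η L₀),
          SubspaceLattice.IsFiniteRank M.1 → SubspaceLattice.IsFiniteRank N.1 →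
          δ (M * A * N) = M.1 * δ (A * N) + δ (M * A) * N.1 - M.1 * δ A * N.1) := by
  have hfin : ∀ A ∈ SubspaceLattice.Alg L₀, SubspaceLattice.IsFiniteRank A →
      A ∈ SubspaceLattice.idempotentSpan (SubspaceLattice.Alg L₀) :=
    fun A hA hAf => hdec.mem_idempotentSpan hspan hA hAf
  refine ⟨fun n _ hn ζ _ hζ δ hδ A M N hM hN => ?_, fun η _ hη δ hδ A M N hM hN => ?_⟩
  · have hcov : (⟨n - 2, by lia⟩ : Fin n) ⋖ ⟨n - 1, by lia⟩ := by
      refine ⟨Fin.mk_lt_mk.2 (by lia), fun c h₁ h₂ => ?_⟩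
      rw [Fin.lt_def] at h₁ h₂
      simp only at h₁ h₂
      lia
    have hmax (i : Fin n) : i ≤ ⟨n - 1, by lia⟩ := Fin.le_def.2 (by simp only; lia)
    have key (T : SubspaceLattice.Alg (SubspaceLattice.extend ζ L₀))
        (hT : SubspaceLattice.IsFiniteRank T.1) :=
      SubspaceLattice.mem_idempotentSpan_of_finite hL₀.top_mem hfin hcov hmax (hζ _) T.2 hT
    exact hδ.map_mul_mul A (key M hM) (key N hN)
  · have key (T : SubspaceLattice.Alg (SubspaceLattice.extend η L₀))
        (hT : SubspaceLattice.IsFiniteRank T.1) :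
        T.1 ∈ SubspaceLattice.idempotentSpan
          (SubspaceLattice.Alg (SubspaceLattice.extend η L₀)) := by
      obtain ⟨k, hk⟩ := SubspaceLattice.exists_range_le_initial hL₀.top_mem T.2 hT
      exact SubspaceLattice.mem_idempotentSpan_of_range_le_initial hL₀.top_mem hfin
        (Nat.lt_succ_self k) (hη _) T.2 hT hk
    exact hδ.map_mul_mul A (key M hM) (key N hN)
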